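/- For a finite simple graph $G$, a vertex $v$ and an integer $r\ge 0$, let $S(v,r)$ be the set of vertices at distance exactly $r$ from $v$ and $N(v,r)$ the set of vertices at distance at most $r$ from $v$ (vertices in different components are at infinite distance). Let $\mathcal G(n,p)$ be the binomial random graph on $n$ labelled vertices, in which each pair of vertices is an edge independently with probability $p$; $\log$ is the natural logarithm. There are an absolute constant $c>0$ and a function $\varepsilon:\mathbb N\to\mathbb R$ with $\varepsilon(n)\to 0$ as $n\to\infty$ such that the following holds. Let $p=p(n)\in[0,1]$ be any sequence such that $d=d(n):=p(n)\,(n-1)\ge \log^3 n$ for all sufficiently large $n$. Then, with probability tending to $1$ as $n\to\infty$, the random graph $G=(V,E)\in\mathcal G(n,p)$ satisfies both of the following conditions. (i) For every $S\subseteq V$, with $s=|S|$, and every integer $r\ge 0$, $$\Big|\bigcup_{v\in S}N(v,r)\Big|\ \ge\ c\,\min\{s d^r,\,n\},$$ and, moreover, if $s d^r<n/\log n$, then $$\Big|\,\Big|\bigcup_{v\in S}N(v,r)\Big|-s d^r\Big|\ \le\ \varepsilon(n)\, s d^r .$$ (ii) For every $v\in V$ and every integer $r\ge 0$ with $\sqrt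 n<d^{r+1}\le\sqrt n\,\log n$ there is a family $\{W(u)\subseteq S(u,r+1): u\in S(v,r)\}$ of pairwise disjoint sets such that, for every $u\in S(v,r)$, $$\big||W(u)|-d^{r+1}\big|\ \le\ \varepsilon(n)\, d^{r+1}.$$ -/

import Mathlib

namespace MeynielGnp

variable {V : Type*}

/-- `S(v, r)`: the vertices whose distance from `v` is precisely `r`. The extended distance is used,
so that a vertex in another component is at infinite distance. -/
def sphere (G : SimpleGraph V) (v : V) (r : ℕ) : Set V :=
  {w | G.edist v w = (r : ℕ∞)}

/-- `N(v, r)`: the vertices whose distance from `v` is at most `r`. -/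
def ball (G : SimpleGraph V) (v : V) (r : ℕ) : Set V :=
  {w | G.edist v w ≤ (r : ℕ∞)}

/-- `x = (1 + o(1)) y`, with the error term bounded by `ε`. -/
def ApproxEq (ε x y : ℝ) : Prop :=
  |x - y| ≤ ε * y

/-- Neighbourhood expansion of a graph on `n` vertices: for every vertex set `S`, `s = |S|`, and
every `r`, the union of the balls `N(v, r)`, `v ∈ S`, has at least `c * min (s d ^ r) n` elements,
and it has `(1 + o(1)) s d ^ r` elements if `s d ^ r < n / log n`. -/
def BallExpansion (G : SimpleGraph V) (d c ε : ℝ) : Prop :=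
  ∀ (S : Set V) (r : ℕ),
    c * min ((S.ncard : ℝ) * d ^ r) (Nat.card V : ℝ) ≤ ((⋃ v ∈ S, ball G v r).ncard : ℝ) ∧
    ((S.ncard : ℝ) * d ^ r < (Nat.card V : ℝ) / Real.log (Nat.card V : ℝ) →
      ApproxEq ε ((⋃ v ∈ S, ball G v r).ncard : ℝ) ((S.ncard : ℝ) * d ^ r))

/-- Disjoint large sets of a graph on `n` vertices: for every vertex `v` and every `r` with
`√n < d ^ (r + 1) ≤ √n log n` there are pairwise disjoint sets `W u ⊆ S(u, r + 1)`, `u ∈ S(v, r)`,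
each with `(1 + o(1)) d ^ (r + 1)` elements. -/
def DisjointSpheres (G : SimpleGraph V) (d ε : ℝ) : Prop :=
  ∀ (v : V) (r : ℕ),
    √(Nat.card V : ℝ) < d ^ (r + 1) →
    d ^ (r + 1) ≤ √(Nat.card V : ℝ) * Real.log (Nat.card V : ℝ) →
    ∃ W : V → Set V,
      (∀ u ∈ sphere G v r, W u ⊆ sphere G u (r + 1)) ∧
      (sphere G v r).PairwiseDisjoint W ∧
      ∀ u ∈ sphere G v r, ApproxEq ε ((W u).ncard : ℝ) (d ^ (r + 1))

end MeynielGnp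

/-! Put `L = log n`. For a fixed set `S` of `s` vertices, the outer boundary is a sum of independent
indicators, one for each vertex outside `S`, so it satisfies Chernoff bounds. If `s d ≤ n`, its mean
is at least `s d / 6`. With relative error `δ = 7 / L` and `d ≥ L ^ 3`, a lower deviation has
probability at most `n ^ (-4 s)`, which survives a union bound over all such `S`. From above it
suffices to control single vertices, since boundaries are subadditive
(`binomialRandom_not_hasTypicalBoundaries_le`).

The rest is deterministic. One step multiplies the size of a set by `d` up to a factor `1 ± 30 / L`,
as long as the result is `O(n / L)`. Since `d ^ r ≤ n` forces `r ≤ L / (3 log L)`, the errors of all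
steps compound to `O(1 / log L)`. This gives (i), with a cruder bound for larger sets. For (ii), (i)
applied to the subsets of `S(v, r)` verifies Hall's condition. -/

namespace MeynielGnp

open MeasureTheory ProbabilityTheory SimpleGraph

/-! ### Chernoff bounds for the outer boundary of a fixed set. -/

section Probability

variable {V : Type*} [Fintype V]

/-- With finitely many graphs, this makes every event measurable and every real function integrable.
-/
instance measurableSingletonClass_simpleGraph : MeasurableSingletonClass (SimpleGraph V) :=
  ⟨fun G => by
    have h := measurableEmbedding_edgeSet (V := V)
    have : ({G} : Set (SimpleGraph V)) = edgeSet ⁻¹' {G.edgeSet} := by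
      ext H; simp
    rw [this]
    exact h.measurable (MeasurableSet.of_discrete)⟩

/-- The probability that the binomial random graph avoids a given set of pairs. -/
lemma binomialRandom_avoid (p : unitInterval) (F : Finset (Sym2 V)) (hF : ∀ e ∈ F, ¬ e.IsDiag) :
    (binomialRandom V p).real {G | ∀ e ∈ F, e ∉ G.edgeSet} = (1 - (p : ℝ)) ^ F.card := by
  have hset : (fromEdgeSet : Set (Sym2 V) → SimpleGraph V) ⁻¹' {G | ∀ e ∈ F, e ∉ G.edgeSet} =
      {s | ∀ e ∈ F, e ∉ s} := by
    ext s
    simp only [Set.mem_preimage, Set.mem_ofPred_eq, edgeSet_fromEdgeSet]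
    refine forall₂_congr fun e he => ?_
    have := hF e he
    simp [this]
  have hpi : ((fun p : Sym2 V → Prop => {i | p i}) ⁻¹' {s | ∀ e ∈ F, e ∉ s}) =
      Set.pi F fun _ => {False} := by
    ext f
    simp [Set.pi]
  rw [measureReal_def, binomialRandom_eq_map, Measure.map_apply measurable_fromEdgeSet
    (Set.toFinite _).measurableSet, hset, setBernoulli_apply', hpi, Measure.infinitePi_pi]
  · rw [Finset.prod_congr rfl (g := fun _ => (unitInterval.toNNReal (unitInterval.symm p) :
      ENNReal))]
    · simp
    · intro e he
      have := hF e he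
      simp [this]
  · intro e _; exact MeasurableSet.of_discrete

variable [DecidableEq V]

open Classical in
/-- The vertices outside `S` with a neighbour in `S`. -/
noncomputable def outerBoundary (G : SimpleGraph V) (S : Finset V) : Finset V :=
  Finset.univ.filter fun w => w ∉ S ∧ ∃ v ∈ S, G.Adj v w

lemma binomialRandom_no_cross (p : unitInterval) (S T : Finset V) (hST : Disjoint S T) :
    (binomialRandom V p).real {G | ∀ w ∈ T, ∀ v ∈ S, ¬ G.Adj v w} =
      ((1 - (p : ℝ)) ^ S.card) ^ T.card := by
  have hne : ∀ v ∈ S, ∀ w ∈ T, v ≠ w := fun v hv w hw h =>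
    Finset.disjoint_left.mp hST hv (h ▸ hw)
  have hinj : Set.InjOn (fun x : V × V => s(x.1, x.2)) (S ×ˢ T : Finset (V × V)) := by
    rintro ⟨a, b⟩ hab ⟨a', b'⟩ hab' h
    simp only [Finset.coe_product, Set.mem_prod, Finset.mem_coe] at hab hab'
    simp only [Sym2.eq_iff] at h
    rcases h with ⟨rfl, rfl⟩ | ⟨rfl, rfl⟩
    · rfl
    · exact absurd rfl (hne _ hab.1 _ hab'.2)
  have := binomialRandom_avoid p ((S ×ˢ T).image fun x : V × V => s(x.1, x.2)) (by
    simp only [Finset.mem_image, Finset.mem_product, Prod.exists]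
    rintro e ⟨a, b, ⟨ha, hb⟩, rfl⟩
    simpa using hne a ha b hb)
  rw [Finset.card_image_of_injOn hinj, Finset.card_product, pow_mul] at this
  rw [← this]
  congr 1
  ext G
  simp only [Set.mem_ofPred_eq, Finset.mem_image, Finset.mem_product, Prod.exists]
  constructor
  · rintro h e ⟨a, b, ⟨ha, hb⟩, rfl⟩
    simpa using h b hb a ha
  · intro h w hw v hv
    simpa using h _ ⟨v, w, ⟨hv, hw⟩, rfl⟩

/-- The moment generating function of the size of the outer boundary of a vertex set. -/
lemma mgf_card_outerBoundary (p : unitInterval) (S : Finset V) (t : ℝ) :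
    mgf (fun G : SimpleGraph V => ((outerBoundary G S).card : ℝ)) (binomialRandom V p) t =
      (1 + (Real.exp t - 1) * (1 - (1 - (p : ℝ)) ^ S.card)) ^ (Fintype.card V - S.card) := by
  classical
  -- Expanding the product over vertices outside `S` leaves only events "no edge between `S` and
  -- `T`", whose probabilities are explicit; the binomial theorem then resums them.
  have hexp : ∀ G : SimpleGraph V, Real.exp (t * ((outerBoundary G S).card : ℝ)) =
      ∑ T ∈ Sᶜ.powerset, ((1 - Real.exp t) ^ T.card * Real.exp t ^ (Sᶜ.card - T.card)) *
        Set.indicator {G : SimpleGraph V | ∀ w ∈ T, ∀ v ∈ S, ¬ G.Adj v w} 1 G := by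
    intro G
    have h1 : Real.exp (t * ((outerBoundary G S).card : ℝ)) =
        ∏ w ∈ Sᶜ, ((1 - Real.exp t) * (if ∀ v ∈ S, ¬ G.Adj v w then 1 else 0) + Real.exp t) := by
      have : outerBoundary G S = Sᶜ.filter fun w => ¬ ∀ v ∈ S, ¬ G.Adj v w := by
        ext w; simp [outerBoundary]
      rw [this, mul_comm, Real.exp_nat_mul, ← Finset.prod_const, Finset.prod_filter]
      refine Finset.prod_congr rfl fun w _ => ?_
      split_ifs <;> simp_all
    rw [h1, Finset.prod_add]
    refine Finset.sum_congr rfl fun T hT => ?_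
    rw [Finset.prod_mul_distrib, Finset.prod_const, Finset.prod_const,
      Finset.card_sdiff_of_subset (Finset.mem_powerset.mp hT), Finset.prod_boole]
    simp only [Set.indicator_apply, Set.mem_ofPred_eq, Pi.one_apply]
    ring_nf
  have hint : ∀ f : SimpleGraph V → ℝ, Integrable f (binomialRandom V p) :=
    fun f => Integrable.of_finite
  rw [mgf, funext hexp, integral_finsetSum _ fun _ _ => hint _]
  rw [← Finset.card_compl]
  have : (1 + (Real.exp t - 1) * (1 - (1 - (p : ℝ)) ^ S.card)) =
      (1 - Real.exp t) * (1 - (p : ℝ)) ^ S.card + Real.exp t := by ring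
  rw [this, ← Finset.sum_pow_mul_eq_add_pow]
  refine Finset.sum_congr rfl fun T hT => ?_
  rw [integral_const_mul, integral_indicator_one (Set.toFinite _).measurableSet,
    binomialRandom_no_cross p S T
      (Finset.disjoint_left.mpr fun a ha hb => by
        simpa [ha] using Finset.mem_powerset.mp hT hb), mul_pow]
  ring

/-- Lower tail of the size of the outer boundary. -/
lemma outerBoundary_lower_tail (p : unitInterval) (S : Finset V) {δ : ℝ} (hδ : 0 ≤ δ)
    {μ : ℝ} (hμ : μ = ((Fintype.card V - S.card : ℕ) : ℝ) * (1 - (1 - (p : ℝ)) ^ S.card)) :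
    (binomialRandom V p).real {G | ((outerBoundary G S).card : ℝ) ≤ (1 - δ) * μ} ≤
      Real.exp (-(δ ^ 2 / 2 * μ)) := by
  have hp0 := p.2.1
  have hp1 := p.2.2
  have hq0 : 0 ≤ 1 - (1 - (p : ℝ)) ^ S.card :=
    sub_nonneg.mpr (pow_le_one₀ (by linarith) (by linarith))
  have hq1 : 1 - (1 - (p : ℝ)) ^ S.card ≤ 1 := by
    have : 0 ≤ (1 - (p : ℝ)) ^ S.card := pow_nonneg (by linarith) _
    linarith
  set q := 1 - (1 - (p : ℝ)) ^ S.card with hq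
  have hμ0 : 0 ≤ μ := by rw [hμ]; positivity
  have hexp : Real.exp (-δ) - 1 ≤ -δ + δ ^ 2 / 2 := by
    have h2 := Real.quadratic_le_exp_of_nonneg hδ
    have : Real.exp (-δ) ≤ (1 + δ + δ ^ 2 / 2)⁻¹ := by
      rw [Real.exp_neg]; exact inv_anti₀ (by positivity) h2
    have h4 : (1 + δ + δ ^ 2 / 2)⁻¹ ≤ 1 - δ + δ ^ 2 / 2 := by
      rw [inv_le_iff_one_le_mul₀ (by positivity)]
      nlinarith [sq_nonneg (δ ^ 2)]
    linarith
  have hle := measure_le_le_exp_mul_mgf (μ := binomialRandom V p)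
    (X := fun G : SimpleGraph V => ((outerBoundary G S).card : ℝ)) (t := -δ) ((1 - δ) * μ)
    (by linarith) Integrable.of_finite
  refine hle.trans ?_
  rw [mgf_card_outerBoundary, ← hq]
  have hb : (1 + (Real.exp (-δ) - 1) * q) ^ (Fintype.card V - S.card) ≤
      Real.exp ((Real.exp (-δ) - 1) * μ) := by
    calc _ ≤ (Real.exp ((Real.exp (-δ) - 1) * q)) ^ (Fintype.card V - S.card) := by
          have h0 : 0 < Real.exp (-δ) := Real.exp_pos _
          refine pow_le_pow_left₀ (by nlinarith) ?_ _
          linarith [Real.add_one_le_exp ((Real.exp (-δ) - 1) * q)]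
      _ = _ := by rw [← Real.exp_nat_mul, hμ]; ring_nf
  calc _ ≤ Real.exp (- -δ * ((1 - δ) * μ)) * Real.exp ((Real.exp (-δ) - 1) * μ) := by gcongr
    _ ≤ _ := by
      rw [← Real.exp_add]
      refine Real.exp_le_exp.mpr ?_
      nlinarith

/-- Upper tail of the size of the outer boundary. -/
lemma outerBoundary_upper_tail (p : unitInterval) (S : Finset V) {δ : ℝ} (hδ : 0 ≤ δ) (hδ1 : δ ≤ 1)
    {μ : ℝ} (hμ : μ = ((Fintype.card V - S.card : ℕ) : ℝ) * (1 - (1 - (p : ℝ)) ^ S.card)) :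
    (binomialRandom V p).real {G | (1 + δ) * μ ≤ ((outerBoundary G S).card : ℝ)} ≤
      Real.exp (-(δ ^ 2 / 4 * μ)) := by
  have hp0 := p.2.1
  have hp1 := p.2.2
  have hq0 : 0 ≤ 1 - (1 - (p : ℝ)) ^ S.card :=
    sub_nonneg.mpr (pow_le_one₀ (by linarith) (by linarith))
  set q := 1 - (1 - (p : ℝ)) ^ S.card with hq
  have hμ0 : 0 ≤ μ := by rw [hμ]; positivity
  have hexp : Real.exp (δ / 2) - 1 ≤ δ / 2 + (δ / 2) ^ 2 := by
    have h := Real.abs_exp_sub_one_sub_id_le (x := δ / 2)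
      (by rw [abs_of_nonneg (by positivity)]; linarith)
    have := (abs_le.mp h).2
    linarith
  have hle := measure_ge_le_exp_mul_mgf (μ := binomialRandom V p)
    (X := fun G : SimpleGraph V => ((outerBoundary G S).card : ℝ)) (t := δ / 2) ((1 + δ) * μ)
    (by linarith) Integrable.of_finite
  refine hle.trans ?_
  rw [mgf_card_outerBoundary, ← hq]
  have hb : (1 + (Real.exp (δ / 2) - 1) * q) ^ (Fintype.card V - S.card) ≤
      Real.exp ((Real.exp (δ / 2) - 1) * μ) := by
    calc _ ≤ (Real.exp ((Real.exp (δ / 2) - 1) * q)) ^ (Fintype.card V - S.card) := by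
          have h0 : 1 ≤ Real.exp (δ / 2) := Real.one_le_exp (by positivity)
          refine pow_le_pow_left₀ (by nlinarith) ?_ _
          linarith [Real.add_one_le_exp ((Real.exp (δ / 2) - 1) * q)]
      _ = _ := by rw [← Real.exp_nat_mul, hμ]; ring_nf
  calc _ ≤ Real.exp (-(δ / 2) * ((1 + δ) * μ)) * Real.exp ((Real.exp (δ / 2) - 1) * μ) := by gcongr
    _ ≤ _ := by
      rw [← Real.exp_add]
      refine Real.exp_le_exp.mpr ?_
      nlinarith

end Probability

end MeynielGnp

namespace MeynielGnp

open MeasureTheory ProbabilityTheory SimpleGraph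

/-! ### Typical boundaries with high probability, by a union bound. -/

section GoodGraphs

/-- Bernoulli's inequality for `(1 + p) ^ s`, combined with `(1 - p) (1 + p) ≤ 1`. -/
lemma div_one_add_le_one_sub_pow {p : ℝ} (hp0 : 0 ≤ p) (hp1 : p ≤ 1) (s : ℕ) :
    s * p / (1 + s * p) ≤ 1 - (1 - p) ^ s := by
  have h1 : 1 + s * p ≤ (1 + p) ^ s := one_add_mul_le_pow (by linarith) s
  have h2 : (1 - p) ^ s * (1 + p) ^ s ≤ 1 := by
    rw [← mul_pow]; exact pow_le_one₀ (by nlinarith) (by nlinarith)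
  have h3 : 0 ≤ (1 - p) ^ s := pow_nonneg (by linarith) _
  have hpos : 0 < 1 + s * p := by positivity
  rw [div_le_iff₀ hpos]
  nlinarith [mul_le_mul_of_nonneg_left h1 h3]

variable {V : Type*} [Fintype V]

/-- Nonemptiness lets a factor `n ^ (-2)` be pulled out; the remaining sum over all sets is `(1 + n
^ (-2)) ^ n ≤ e`. -/
lemma sum_pow_card_nonempty_le {n : ℕ} (hV : Fintype.card V = n) (hn : 1 ≤ n) :
    ∑ S ∈ (Finset.univ : Finset (Finset V)).filter (·.Nonempty), (((n : ℝ) ^ 4)⁻¹) ^ S.card ≤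
      3 / n := by
  have hn' : (1 : ℝ) ≤ n := by exact_mod_cast hn
  have hle1 : ((n : ℝ) ^ 2)⁻¹ ≤ 1 := inv_le_one_of_one_le₀ (one_le_pow₀ hn')
  calc _ ≤ ∑ S ∈ (Finset.univ : Finset (Finset V)).filter (·.Nonempty),
        ((n : ℝ) ^ 2)⁻¹ * (((n : ℝ) ^ 2)⁻¹) ^ S.card := by
        refine Finset.sum_le_sum fun S hS => ?_
        have hc : 1 ≤ S.card := Finset.card_pos.mpr (Finset.mem_filter.mp hS).2
        have h4 : ((n : ℝ) ^ 4)⁻¹ = ((n : ℝ) ^ 2)⁻¹ * ((n : ℝ) ^ 2)⁻¹ := by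
          rw [← mul_inv]; ring_nf
        rw [h4, mul_pow]
        gcongr
        exact pow_le_of_le_one (by positivity) hle1 (by omega)
    _ ≤ ∑ S : Finset V, ((n : ℝ) ^ 2)⁻¹ * (((n : ℝ) ^ 2)⁻¹) ^ S.card :=
        Finset.sum_le_sum_of_subset_of_nonneg (Finset.filter_subset _ _)
          fun _ _ _ => by positivity
    _ = ((n : ℝ) ^ 2)⁻¹ * (((n : ℝ) ^ 2)⁻¹ + 1) ^ n := by
        rw [← Finset.mul_sum, ← hV, ← Fintype.sum_pow_mul_eq_add_pow]
        simp
    _ ≤ ((n : ℝ) ^ 2)⁻¹ * 3 := by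
        gcongr
        calc (((n : ℝ) ^ 2)⁻¹ + 1) ^ n ≤ Real.exp (((n : ℝ) ^ 2)⁻¹) ^ n := by
              gcongr; exact Real.add_one_le_exp _
          _ = Real.exp (n * ((n : ℝ) ^ 2)⁻¹) := by rw [Real.exp_nat_mul]
          _ ≤ Real.exp 1 := by
              refine Real.exp_le_exp.mpr ?_
              rw [mul_inv_le_iff₀ (by positivity)]
              nlinarith
          _ ≤ 3 := Real.exp_one_lt_three.le
    _ ≤ 3 / n := by
        rw [inv_mul_eq_div]
        gcongr
        nlinarith

variable [DecidableEq V]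

/-- The expected size of the outer boundary of a set of `s` vertices in the binomial random graph
on `n` vertices. -/
noncomputable def boundaryMean (n : ℕ) (p : ℝ) (s : ℕ) : ℝ := ((n - s : ℕ) : ℝ) * (1 - (1 - p) ^ s)

/-- Outer boundaries of small sets are almost as large as expected, and the degrees are not much
larger than expected. -/
structure HasTypicalBoundaries (G : SimpleGraph V) (p d δ : ℝ) : Prop where
  lower : ∀ S : Finset V, S.Nonempty → S.card * d ≤ Fintype.card V →
    (1 - δ) * boundaryMean (Fintype.card V) p S.card ≤ (outerBoundary G S).card
  upper : ∀ v : V, ((outerBoundary G {v}).card : ℝ) ≤ (1 + δ) * d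

/-- Here `s ≤ n / 4` and `s p ≤ 2`, so at least `(n - 1) / 2` vertices lie outside the set, and each
is hit with probability at least `s p / 3`. -/
lemma div_six_le_boundaryMean {n s : ℕ} {p d : ℝ} (hn : 2 ≤ n) (hp0 : 0 ≤ p) (hp1 : p ≤ 1)
    (hd : d = p * (n - 1)) (hd4 : 4 ≤ d) (hs : s * d ≤ n) :
    s * d / 6 ≤ boundaryMean n p s := by
  have hn' : (2 : ℝ) ≤ n := by exact_mod_cast hn
  have hs4 : (s : ℝ) * 4 ≤ n := (mul_le_mul_of_nonneg_left hd4 (by positivity)).trans hs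
  have hsn : s ≤ n := by
    have : (s : ℝ) ≤ n := by linarith [(Nat.cast_nonneg s : (0 : ℝ) ≤ s)]
    exact_mod_cast this
  have hsp : s * p ≤ 2 := by
    have : (s * p) * (n - 1) ≤ 2 * ((n : ℝ) - 1) := by
      calc _ = s * d := by rw [hd]; ring
        _ ≤ _ := by linarith
    exact le_of_mul_le_mul_right this (by linarith)
  have hq := div_one_add_le_one_sub_pow hp0 hp1 s
  have hq3 : s * p / 3 ≤ 1 - (1 - p) ^ s := by
    refine le_trans ?_ hq
    exact div_le_div_of_nonneg_left (by positivity) (by positivity) (by linarith)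
  unfold boundaryMean
  rw [Nat.cast_sub hsn]
  calc s * d / 6 = (n - 1) / 2 * (s * p / 3) := by rw [hd]; ring
    _ ≤ (n - s) * (1 - (1 - p) ^ s) := by
      gcongr
      · linarith
      · linarith

lemma boundaryMean_one {n : ℕ} {p : ℝ} (hn : 1 ≤ n) : boundaryMean n p 1 = p * (n - 1) := by
  simp [boundaryMean, Nat.cast_sub hn, mul_comm]

/-- A binomial random graph has typical boundaries with high probability. -/
lemma binomialRandom_not_hasTypicalBoundaries_le (p : unitInterval) {n : ℕ}
    (hV : Fintype.card V = n) (hn : 2 ≤ n) {d δ : ℝ} (hd : d = p * (n - 1)) (hd4 : 4 ≤ d)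
    (hδ0 : 0 ≤ δ) (hδ1 : δ ≤ 1) (hδ : 48 * Real.log n ≤ δ ^ 2 * d) :
    (binomialRandom V p).real {G | ¬ HasTypicalBoundaries G (p : ℝ) d δ} ≤ 4 / n := by
  have hn0 : (0 : ℝ) < n := by positivity
  have hn2 : (2 : ℝ) ≤ n := by exact_mod_cast hn
  set P := binomialRandom V p
  set 𝒮 := (Finset.univ : Finset (Finset V)).filter
    fun S => S.Nonempty ∧ S.card * d ≤ Fintype.card V
  have hsub : {G | ¬ HasTypicalBoundaries G (p : ℝ) d δ} ⊆
      (⋃ S ∈ 𝒮, {G | ((outerBoundary G S).card : ℝ) ≤ (1 - δ) * boundaryMean n p S.card}) ∪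
      ⋃ v ∈ (Finset.univ : Finset V), {G | (1 + δ) * d ≤ ((outerBoundary G {v}).card : ℝ)} := by
    intro G hG
    by_contra hcon
    simp only [Set.mem_union, Set.mem_iUnion, Set.mem_ofPred_eq, not_or, not_exists, not_le,
      Finset.mem_univ, true_implies] at hcon
    refine hG ⟨fun S hS hSd => ?_, fun v => (hcon.2 v).le⟩
    rw [hV]
    exact (hcon.1 S (by simp [𝒮, hS, hSd])).le
  have hexp4 : Real.exp (-(4 * Real.log n)) = ((n : ℝ) ^ 4)⁻¹ := by
    rw [Real.exp_neg, show (4 : ℝ) * Real.log n = ((4 : ℕ) : ℝ) * Real.log n by norm_num,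
      Real.exp_nat_mul, Real.exp_log hn0]
  have h1 : ∑ S ∈ 𝒮, P.real
      {G | ((outerBoundary G S).card : ℝ) ≤ (1 - δ) * boundaryMean n p S.card} ≤ 3 / n := by
    refine le_trans ?_ (sum_pow_card_nonempty_le hV (by omega))
    calc _ ≤ ∑ S ∈ 𝒮, (((n : ℝ) ^ 4)⁻¹) ^ S.card := by
          refine Finset.sum_le_sum fun S hS => ?_
          obtain ⟨-, hS⟩ := Finset.mem_filter.mp hS
          rw [hV] at hS
          have hm := div_six_le_boundaryMean hn p.2.1 p.2.2 hd hd4 hS.2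
          refine (outerBoundary_lower_tail p S hδ0 (by rw [hV]; rfl)).trans ?_
          rw [← hexp4, ← Real.exp_nat_mul]
          refine Real.exp_le_exp.mpr ?_
          -- The constant 48 is `4 * 12`: the Chernoff exponent is at least `δ ^ 2 s d / 12`, hence
          -- at least `4 s log n`.
          have h2 : δ ^ 2 / 2 * (S.card * d / 6) ≤ δ ^ 2 / 2 * boundaryMean n p S.card := by gcongr
          have h3 : (S.card : ℝ) * (48 * Real.log n) ≤ S.card * (δ ^ 2 * d) := by gcongr
          linarith
      _ ≤ _ := by
          refine Finset.sum_le_sum_of_subset_of_nonneg ?_ fun _ _ _ => by positivity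
          intro S hS
          simp only [𝒮, Finset.mem_filter] at hS ⊢
          exact ⟨hS.1, hS.2.1⟩
  have h2 : ∑ v : V, P.real {G | (1 + δ) * d ≤ ((outerBoundary G {v}).card : ℝ)} ≤ 1 / n := by
    calc _ ≤ ∑ _v : V, ((n : ℝ) ^ 4)⁻¹ := by
          refine Finset.sum_le_sum fun v _ => ?_
          refine (outerBoundary_upper_tail p {v} hδ0 hδ1 (μ := d) ?_).trans ?_
          · rw [hV, hd, ← boundaryMean_one (by omega)]; simp [boundaryMean]
          · rw [← hexp4]
            refine Real.exp_le_exp.mpr ?_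
            have : 0 ≤ Real.log n := Real.log_nonneg (by linarith)
            linarith
      _ = n * ((n : ℝ) ^ 4)⁻¹ := by simp [hV]
      _ ≤ 1 / n := by
          rw [mul_inv_le_iff₀ (by positivity), one_div, inv_mul_eq_div, le_div_iff₀ hn0]
          nlinarith [pow_le_pow_right₀ (show (1 : ℝ) ≤ n by linarith) (show 2 ≤ 4 by norm_num)]
  calc P.real {G | ¬ HasTypicalBoundaries G (p : ℝ) d δ}
      ≤ _ := measureReal_mono hsub
    _ ≤ _ := measureReal_union_le _ _
    _ ≤ 3 / n + 1 / n := add_le_add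
        ((measureReal_biUnion_finset_le _ _).trans h1) ((measureReal_biUnion_finset_le _ _).trans h2)
    _ = 4 / n := by ring

end GoodGraphs

end MeynielGnp

namespace MeynielGnp

open SimpleGraph

/-! ### One-step expansion of closed neighbourhoods. -/

section Deterministic

variable {V : Type*} [Fintype V] [DecidableEq V]

lemma disjoint_outerBoundary (G : SimpleGraph V) (A : Finset V) :
    Disjoint A (outerBoundary G A) := by
  rw [Finset.disjoint_left]
  intro a ha hb
  simp [outerBoundary, ha] at hb

lemma card_union_outerBoundary (G : SimpleGraph V) (A : Finset V) :
    (A ∪ outerBoundary G A).card = A.card + (outerBoundary G A).card :=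
  Finset.card_union_of_disjoint (disjoint_outerBoundary G A)

lemma union_outerBoundary_mono (G : SimpleGraph V) {A B : Finset V} (h : A ⊆ B) :
    A ∪ outerBoundary G A ⊆ B ∪ outerBoundary G B := by
  intro w hw
  simp only [outerBoundary, Finset.mem_union, Finset.mem_filter, Finset.mem_univ, true_and] at hw ⊢
  by_cases hB : w ∈ B
  · exact Or.inl hB
  · rcases hw with hw | ⟨-, v, hv, hvw⟩
    · exact absurd (h hw) hB
    · exact Or.inr ⟨hB, v, h hv, hvw⟩

lemma card_outerBoundary_le_sum (G : SimpleGraph V) (A : Finset V) :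
    (outerBoundary G A).card ≤ ∑ v ∈ A, (outerBoundary G {v}).card := by
  refine (Finset.card_le_card ?_).trans Finset.card_biUnion_le
  intro w hw
  simp only [outerBoundary, Finset.mem_filter, Finset.mem_univ, true_and, Finset.mem_biUnion,
    Finset.mem_singleton, exists_eq_left] at hw ⊢
  obtain ⟨hw, v, hv, hvw⟩ := hw
  exact ⟨v, hv, hvw.ne', hvw⟩

/-- Expansion of closed neighbourhoods in a graph on `n` vertices, with relative error `η` for sets
of at most `4 n / (L d)` vertices. -/
structure HasOneStepExpansion (G : SimpleGraph V) (d L η : ℝ) : Prop where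
  upper : ∀ A : Finset V, ((A ∪ outerBoundary G A).card : ℝ) ≤ (1 + η) * (A.card * d)
  lower : ∀ A : Finset V, A.card * d ≤ 4 * Fintype.card V / L →
    (1 - η) * (A.card * d) ≤ (A ∪ outerBoundary G A).card
  lower_min : ∀ A : Finset V, min (A.card * d) (Fintype.card V) / 24 ≤
    (A ∪ outerBoundary G A).card

/-- The error `30 / L` covers `7 / L` from concentration plus `23 / L` for `A` itself in the upper
bound. In the lower bound it covers `7 / L` and twice `8 / L`, for the vertices lost to `A` and for
overlapping neighbourhoods. -/
lemma HasTypicalBoundaries.hasOneStepExpansion {G : SimpleGraph V} {p d L : ℝ} {n : ℕ}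
    (hV : Fintype.card V = n) (hn : 2 ≤ n) (hp0 : 0 ≤ p) (hp1 : p ≤ 1) (hd : d = p * (n - 1))
    (hL : 20 ≤ L) (hLd : L ^ 3 ≤ d) (hG : HasTypicalBoundaries G p d (7 / L)) :
    HasOneStepExpansion G d L (30 / L) := by
  have hn2 : (2 : ℝ) ≤ n := by exact_mod_cast hn
  have hL0 : 0 < L := by linarith
  have hdL : 400 * L ≤ d := by nlinarith [mul_nonneg hL0.le (sub_nonneg.mpr hL), sq_nonneg L]
  have hd4 : 4 ≤ d := by linarith
  have hd0 : 0 < d := by linarith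
  have hdn : d ≤ n := by rw [hd]; nlinarith
  have hδ : 7 / L ≤ 1 / 2 := by rw [div_le_div_iff₀ hL0 (by norm_num)]; linarith
  have small : ∀ A : Finset V, A.card * d ≤ n → A.card * d / 12 ≤ (A ∪ outerBoundary G A).card := by
    intro A hA
    rcases A.eq_empty_or_nonempty with rfl | hne
    · simp
    have h1 := hG.lower A hne (by rw [hV]; exact hA)
    rw [hV] at h1
    have h2 := div_six_le_boundaryMean hn hp0 hp1 hd hd4 hA
    rw [card_union_outerBoundary]
    push_cast
    have h0 : 0 ≤ (A.card : ℝ) * d := by positivity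
    have : 0 ≤ boundaryMean n p A.card := by linarith
    nlinarith [(Nat.cast_nonneg A.card : (0 : ℝ) ≤ A.card)]
  refine ⟨fun A => ?_, fun A hA => ?_, fun A => ?_⟩
  · have h1 : ((outerBoundary G A).card : ℝ) ≤ A.card * ((1 + 7 / L) * d) := by
      calc ((outerBoundary G A).card : ℝ) ≤ ∑ v ∈ A, ((outerBoundary G {v}).card : ℝ) := by
            exact_mod_cast card_outerBoundary_le_sum G A
        _ ≤ ∑ _v ∈ A, (1 + 7 / L) * d := Finset.sum_le_sum fun v _ => hG.upper v
        _ = _ := by simp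
    have h2 : (1 : ℝ) ≤ 23 / L * d := by
      rw [div_mul_eq_mul_div, le_div_iff₀ hL0]; linarith
    have h3 : (A.card : ℝ) * 1 ≤ A.card * (23 / L * d) := by gcongr
    rw [card_union_outerBoundary]
    push_cast
    calc (A.card : ℝ) + (outerBoundary G A).card
        ≤ A.card * (23 / L * d) + A.card * ((1 + 7 / L) * d) := by linarith
      _ = _ := by ring
  · rcases A.eq_empty_or_nonempty with rfl | hne
    · simp
    rw [hV] at hA
    have hs1 : (1 : ℝ) ≤ A.card := by exact_mod_cast Finset.card_pos.mpr hne
    have hAn : (A.card : ℝ) * d ≤ n := by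
      refine hA.trans ?_
      rw [div_le_iff₀ hL0]; nlinarith
    have h1 := hG.lower A hne (by rw [hV]; exact hAn)
    rw [hV] at h1
    have hsn : A.card ≤ n := hV ▸ Finset.card_le_univ A
    set s : ℝ := (A.card : ℝ) with hs
    have hn1 : (0 : ℝ) < n - 1 := by linarith
    have hsp : s * p ≤ 8 / L := by
      have h3 : s * p * (n - 1) ≤ 8 / L * (n - 1) := by
        calc s * p * (n - 1) = s * d := by rw [hd]; ring
          _ ≤ 4 * n / L := hA
          _ ≤ 4 * (2 * (n - 1)) / L := by gcongr; linarith
          _ = _ := by ring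
      exact le_of_mul_le_mul_right h3 hn1
    have hsp0 : 0 ≤ s * p := by positivity
    have hq : s * p * (1 - 8 / L) ≤ 1 - (1 - p) ^ A.card := by
      refine le_trans ?_ (div_one_add_le_one_sub_pow hp0 hp1 A.card)
      rw [← hs, le_div_iff₀ (by positivity)]
      nlinarith [mul_nonneg hsp0 hsp0, mul_nonneg hsp0 (sub_nonneg.mpr hsp)]
    have hns : (n - 1) * (1 - 8 / L) ≤ (n : ℝ) - s := by
      have h3 : s * L ≤ s * d := by gcongr; linarith
      have h4 : s ≤ 4 * n / L / L := by
        rw [le_div_iff₀ hL0]; linarith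
      have h5 : 4 * n / L / L ≤ 8 / L * (n - 1) := by
        rw [div_le_iff₀ hL0, div_mul_eq_mul_div, div_mul_eq_mul_div, div_le_div_iff_of_pos_right hL0]
        nlinarith
      linarith
    have hL8 : 0 ≤ 1 - 8 / L := by
      rw [sub_nonneg, div_le_one hL0]; linarith
    have hm : (n - 1) * (1 - 8 / L) * (s * p * (1 - 8 / L)) ≤ boundaryMean n p A.card := by
      unfold boundaryMean
      rw [Nat.cast_sub hsn]
      have := hns.trans' (by positivity : 0 ≤ ((n : ℝ) - 1) * (1 - 8 / L))
      gcongr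
    have hx0 : 0 ≤ 1 / L := by positivity
    have hx : 1 / L ≤ 1 / 20 := one_div_le_one_div_of_le (by norm_num) hL
    rw [card_union_outerBoundary]
    push_cast
    rw [← hs]
    have hsd : 0 ≤ s * d := by positivity
    have hδ0 : 0 ≤ 1 - 7 / L := by linarith
    calc (1 - 30 / L) * (s * d)
        ≤ ((1 - 7 / L) * (1 - 8 / L) ^ 2) * (s * d) := by
          gcongr
          rw [show 30 / L = 30 * (1 / L) by ring, show 7 / L = 7 * (1 / L) by ring,
            show 8 / L = 8 * (1 / L) by ring]
          nlinarith [mul_nonneg hx0 hx0]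
      _ = (1 - 7 / L) * ((n - 1) * (1 - 8 / L) * (s * p * (1 - 8 / L))) := by rw [hd]; ring
      _ ≤ (1 - 7 / L) * boundaryMean n p A.card := by gcongr
      _ ≤ s + (outerBoundary G A).card := by linarith
  · rw [hV]
    rcases le_total ((A.card : ℝ) * d) n with h | h
    · rw [min_eq_left h]
      have h0 : 0 ≤ (A.card : ℝ) * d := by positivity
      linarith [small A h]
    rw [min_eq_right h]
    -- A large `A` is cut down to `⌊n / d⌋` vertices, where `small` applies; rounding costs the
    -- factor 2 between 12 and 24.
    obtain ⟨B, hBA, hB⟩ := Finset.exists_subset_card_eq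
      (show ⌊(n : ℝ) / d⌋₊ ≤ A.card from Nat.floor_le_of_le ((div_le_iff₀ hd0).mpr h))
    have hle : (⌊(n : ℝ) / d⌋₊ : ℝ) * d ≤ n :=
      (le_div_iff₀ hd0).mp (Nat.floor_le (by positivity))
    have hge : (n : ℝ) / 2 ≤ ⌊(n : ℝ) / d⌋₊ * d := by
      have h1 : 1 ≤ (n : ℝ) / d := (one_le_div hd0).mpr hdn
      have h2 : (1 : ℝ) ≤ ⌊(n : ℝ) / d⌋₊ := by exact_mod_cast Nat.le_floor (by simpa using h1)
      have h3 : (n : ℝ) / d < ⌊(n : ℝ) / d⌋₊ + 1 := Nat.lt_floor_add_one _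
      rw [div_lt_iff₀ hd0] at h3
      nlinarith
    have h4 := small B (by rw [hB]; exact hle)
    rw [hB] at h4
    have h5 : ((B ∪ outerBoundary G B).card : ℝ) ≤ (A ∪ outerBoundary G A).card := by
      exact_mod_cast Finset.card_le_card (union_outerBoundary_mono G hBA)
    linarith

end Deterministic

end MeynielGnp

namespace MeynielGnp

open SimpleGraph

/-! ### Iterating the expansion from one step to balls. -/

section Growth

lemma mem_ball_succ {V : Type*} {G : SimpleGraph V} {v w : V} {r : ℕ} :
    w ∈ ball G v (r + 1) ↔ w ∈ ball G v r ∨ ∃ u ∈ ball G v r, G.Adj u w := by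
  simp only [ball, Set.mem_ofPred_eq]
  constructor
  · intro h
    -- The walk is taken from `w` to `v`, so that removing its first edge exposes the neighbour of
    -- `w`.
    have hne : G.edist w v ≠ ⊤ := by
      rw [edist_comm]; exact ne_top_of_le_ne_top (ENat.natCast_ne_top _) h
    obtain ⟨q, hq⟩ := exists_walk_of_edist_ne_top hne
    cases q with
    | nil => left; simp
    | cons hadj q =>
      rename_i u
      right
      refine ⟨u, ?_, hadj.symm⟩
      rw [edist_comm, ← hq, Walk.length_cons] at h
      rw [edist_comm]
      refine (edist_le q).trans ?_
      have : q.length + 1 ≤ r + 1 := by exact_mod_cast h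
      exact_mod_cast Nat.le_of_succ_le_succ this
  · rintro (h | ⟨u, hu, huw⟩)
    · exact h.trans (by exact_mod_cast Nat.le_succ r)
    · refine (G.edist_triangle (v := u)).trans ?_
      rw [edist_eq_one_iff_adj.mpr huw]
      push_cast
      gcongr

variable {V : Type*} [Fintype V]

open Classical in
/-- The vertices at distance at most `r` from a vertex set. -/
noncomputable def ballFinset (G : SimpleGraph V) (S : Finset V) (r : ℕ) : Finset V :=
  Finset.univ.filter fun w => ∃ v ∈ S, w ∈ ball G v r

@[simp] lemma mem_ballFinset {G : SimpleGraph V} {S : Finset V} {r : ℕ} {w : V} :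
    w ∈ ballFinset G S r ↔ ∃ v ∈ S, w ∈ ball G v r := by
  simp [ballFinset]

lemma biUnion_ball_eq (G : SimpleGraph V) (S : Finset V) (r : ℕ) :
    (⋃ v ∈ (S : Set V), ball G v r) = (ballFinset G S r : Set V) := by
  ext w; simp

lemma ballFinset_zero (G : SimpleGraph V) (S : Finset V) : ballFinset G S 0 = S := by
  ext w; simp [ball]

variable [DecidableEq V]

lemma ballFinset_succ (G : SimpleGraph V) (S : Finset V) (r : ℕ) :
    ballFinset G S (r + 1) = ballFinset G S r ∪ outerBoundary G (ballFinset G S r) := by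
  ext w
  simp only [mem_ballFinset, mem_ball_succ, outerBoundary, Finset.mem_union, Finset.mem_filter,
    Finset.mem_univ, true_and]
  constructor
  · rintro ⟨v, hv, h | ⟨u, hu, huw⟩⟩
    · exact Or.inl ⟨v, hv, h⟩
    · by_cases hw : ∃ v ∈ S, w ∈ ball G v r
      · exact Or.inl hw
      · exact Or.inr ⟨hw, u, ⟨v, hv, hu⟩, huw⟩
  · rintro (⟨v, hv, h⟩ | ⟨-, u, ⟨v, hv, hu⟩, huw⟩)
    · exact ⟨v, hv, Or.inl h⟩
    · exact ⟨v, hv, Or.inr ⟨u, hu, huw⟩⟩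

/-- Iterated expansion: upper and lower bounds with compounded errors. -/
lemma HasOneStepExpansion.card_ballFinset_pow_bounds {G : SimpleGraph V} {d L η : ℝ}
    (hG : HasOneStepExpansion G d L η) (hd : 1 ≤ d) (hη0 : 0 ≤ η) (hη1 : η ≤ 1)
    (S : Finset V) (r : ℕ) (hr2 : (1 + η) ^ r ≤ 2)
    (hr : S.card * d ^ r ≤ 2 * Fintype.card V / L) :
    (1 - η) ^ r * (S.card * d ^ r) ≤ (ballFinset G S r).card ∧
      ((ballFinset G S r).card : ℝ) ≤ (1 + η) ^ r * (S.card * d ^ r) := by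
  induction r with
  | zero => simp [ballFinset_zero]
  | succ r ih =>
    have hpow : (S.card : ℝ) * d ^ r ≤ S.card * d ^ (r + 1) := by
      gcongr
      exact Nat.le_succ r
    have hη2 : (1 + η) ^ r ≤ 2 :=
      (pow_le_pow_right₀ (by linarith) (Nat.le_succ r)).trans hr2
    obtain ⟨ih1, ih2⟩ := ih hη2 (hpow.trans hr)
    rw [ballFinset_succ]
    set A := ballFinset G S r
    -- The range `4 n / L` of one-step expansion is twice `2 n / L` because the accumulated factor
    -- `(1 + η) ^ r` may reach 2.
    have hAd : A.card * d ≤ 4 * Fintype.card V / L := by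
      calc A.card * d ≤ (1 + η) ^ r * (S.card * d ^ r) * d := by gcongr
        _ ≤ 2 * (S.card * d ^ r) * d := by gcongr
        _ = 2 * (S.card * d ^ (r + 1)) := by ring
        _ ≤ 2 * (2 * Fintype.card V / L) := by gcongr
        _ = _ := by ring
    constructor
    · refine le_trans ?_ (hG.lower A hAd)
      calc _ = (1 - η) * ((1 - η) ^ r * (S.card * d ^ r) * d) := by ring
        _ ≤ _ := by gcongr
    · refine (hG.upper A).trans ?_
      calc _ ≤ (1 + η) * ((1 + η) ^ r * (S.card * d ^ r) * d) := by gcongr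
        _ = _ := by ring

/-- Iterated expansion with one error term that does not depend on the radius. -/
lemma HasOneStepExpansion.card_ballFinset_bounds {G : SimpleGraph V} {d L η θ : ℝ}
    (hG : HasOneStepExpansion G d L η) (hd : 1 ≤ d) (hη0 : 0 ≤ η) (hη1 : η ≤ 1) (hθ : θ ≤ 1 / 2)
    (hrad : ∀ r : ℕ, d ^ r ≤ Fintype.card V → r * η ≤ θ) (hL : 2 ≤ L)
    (S : Finset V) (r : ℕ) (hr : S.card * d ^ r ≤ 2 * Fintype.card V / L) :
    (1 - θ) * (S.card * d ^ r) ≤ (ballFinset G S r).card ∧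
      ((ballFinset G S r).card : ℝ) ≤ (1 + 2 * θ) * (S.card * d ^ r) := by
  rcases S.eq_empty_or_nonempty with rfl | hne
  · simp [ballFinset]
  have hs1 : (1 : ℝ) ≤ S.card := by exact_mod_cast Finset.card_pos.mpr hne
  have hrη : r * η ≤ θ := by
    refine hrad r ?_
    calc d ^ r ≤ S.card * d ^ r := le_mul_of_one_le_left (by positivity) hs1
      _ ≤ 2 * Fintype.card V / L := hr
      _ ≤ _ := by
        rw [div_le_iff₀ (by linarith), mul_comm]
        gcongr
  have hrη0 : 0 ≤ r * η := by positivity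
  have hup : (1 + η) ^ r ≤ 1 + 2 * θ := by
    calc (1 + η) ^ r ≤ Real.exp η ^ r := by
          gcongr; linarith [Real.add_one_le_exp η]
      _ = Real.exp (r * η) := (Real.exp_nat_mul _ _).symm
      _ ≤ Real.exp θ := Real.exp_le_exp.mpr hrη
      _ ≤ 1 + 2 * θ := by
        have h := (abs_le.mp (Real.abs_exp_sub_one_sub_id_le (x := θ)
          (by rw [abs_of_nonneg (by linarith)]; linarith))).2
        nlinarith
  have hlow : 1 - θ ≤ (1 - η) ^ r := by
    have h := one_add_mul_le_pow (a := -η) (by linarith) r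
    rw [← sub_eq_add_neg] at h
    linarith
  obtain ⟨h1, h2⟩ := hG.card_ballFinset_pow_bounds hd hη0 hη1 S r (by linarith) hr
  exact ⟨le_trans (by gcongr) h1, h2.trans (by gcongr)⟩

lemma HasOneStepExpansion.ballExpansion {G : SimpleGraph V} {d L η θ : ℝ}
    (hG : HasOneStepExpansion G d L η) (hη0 : 0 ≤ η) (hη1 : η ≤ 1) (hθ : θ ≤ 1 / 2)
    (hrad : ∀ r : ℕ, d ^ r ≤ Fintype.card V → r * η ≤ θ) (hL : 2 ≤ L)
    (hLlog : L = Real.log (Fintype.card V)) (hd : 24 * L ≤ d) :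
    BallExpansion G d (1 / 48) (2 * θ) := by
  intro S r
  obtain ⟨S, rfl⟩ := S.toFinite.exists_finset_coe
  rw [biUnion_ball_eq, Set.ncard_coe_finset, Set.ncard_coe_finset, Nat.card_eq_fintype_card,
    ← hLlog]
  have hL0 : 0 < L := by linarith
  set n : ℝ := (Fintype.card V : ℝ) with hn
  have hn0 : 0 ≤ n := by positivity
  have hb := hG.card_ballFinset_bounds (by linarith) hη0 hη1 hθ hrad hL S
  have hd0 : 0 < d := by linarith
  constructor
  · induction r with
    | zero =>
      rw [ballFinset_zero, pow_zero, mul_one]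
      have h0 : (0 : ℝ) ≤ S.card := by positivity
      linarith [min_le_left (S.card : ℝ) n]
    | succ r ih =>
      rw [ballFinset_succ]
      refine le_trans ?_ (hG.lower_min _)
      set A := ballFinset G S r
      rw [← hn]
      -- Below the threshold the sharp bounds lose at most a factor 2 before the last step, whence
      -- `1 / 48 = 1 / 2 * 1 / 24`. Above it, the induction hypothesis and `d ≥ 24 L` give `n ≤ |A|
      -- d`, so the constant does not deteriorate with `r`.
      rcases le_or_gt ((S.card : ℝ) * d ^ r) (2 * n / L) with h | h
      · have h1 := (hb r h).1
        have h2 : (S.card : ℝ) * d ^ r / 2 ≤ A.card := by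
          refine le_trans ?_ h1
          have : 0 ≤ (S.card : ℝ) * d ^ r := by positivity
          nlinarith
        have h3 : (S.card : ℝ) * d ^ (r + 1) / 2 ≤ A.card * d := by
          calc _ = (S.card : ℝ) * d ^ r / 2 * d := by ring
            _ ≤ _ := by gcongr
        have h4 : min ((S.card : ℝ) * d ^ (r + 1)) n / 2 ≤ min (A.card * d) n := by
          refine le_min ?_ ?_
          · linarith [min_le_left ((S.card : ℝ) * d ^ (r + 1)) n]
          · linarith [min_le_right ((S.card : ℝ) * d ^ (r + 1)) n]
        linarith
      · have h1 : 2 * n / L ≤ min ((S.card : ℝ) * d ^ r) n := by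
          refine le_min h.le ?_
          rw [div_le_iff₀ hL0, mul_comm]
          gcongr
        have h2 : n ≤ A.card * d := by
          calc n = 1 / 48 * (2 * n / L) * (24 * L) := by field_simp; ring
            _ ≤ A.card * d := by
              gcongr
              linarith
        rw [min_eq_right h2]
        linarith [min_le_right ((S.card : ℝ) * d ^ (r + 1)) n]
  · intro h
    have h0 : 0 ≤ n / L := by positivity
    obtain ⟨h1, h2⟩ := hb r (h.le.trans (by rw [mul_div_assoc]; linarith))
    have h3 : 0 ≤ (S.card : ℝ) * d ^ r := by positivity
    rw [ApproxEq, abs_le]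
    constructor <;> nlinarith

/-! ### Disjoint large subsets of spheres, by Hall's theorem. -/

/-- Hall's theorem for disjoint families of sets of the same size. -/
lemma exists_pairwiseDisjoint_subsets_of_card {ι α : Type*} [DecidableEq ι] [DecidableEq α]
    (I : Finset ι) (t : ι → Finset α) (k : ℕ)
    (h : ∀ U ⊆ I, U.card * k ≤ (U.biUnion t).card) :
    ∃ W : ι → Finset α, (∀ i ∈ I, W i ⊆ t i ∧ (W i).card = k) ∧
      (I : Set ι).PairwiseDisjoint W := by
  -- Each index is replaced by `k` copies, so a system of distinct representatives picks `k`
  -- elements for each.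
  have hall := (Finset.all_card_le_biUnion_card_iff_exists_injective
    (fun x : I × Fin k => t x.1)).mp (by
      intro A
      set U : Finset ι := A.image fun x => (x.1 : ι) with hU
      have hUI : U ⊆ I := by
        intro i hi
        obtain ⟨x, -, rfl⟩ := Finset.mem_image.mp hi
        exact x.1.2
      have h1 : A.card ≤ U.card * k := by
        have hinj : A.card ≤ (U ×ˢ (Finset.univ : Finset (Fin k))).card := by
          refine Finset.card_le_card_of_injOn (fun x => ((x.1 : ι), x.2)) ?_ ?_
          · intro x hx
            simp only [Finset.coe_product, Set.mem_prod, Finset.coe_univ, Set.mem_univ, and_true]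
            exact Finset.mem_image_of_mem _ hx
          · rintro ⟨a, i⟩ - ⟨b, j⟩ - hab
            simp only [Prod.mk.injEq] at hab
            exact Prod.ext (Subtype.ext hab.1) hab.2
        simpa using hinj
      refine h1.trans ((h U hUI).trans (Finset.card_le_card ?_))
      intro a ha
      simp only [hU, Finset.mem_biUnion, Finset.mem_image, exists_exists_and_eq_and] at ha ⊢
      exact ha)
  obtain ⟨f, hf, hft⟩ := hall
  refine ⟨fun i => if hi : i ∈ I then Finset.univ.image fun j => f (⟨i, hi⟩, j) else ∅, ?_, ?_⟩
  · intro i hi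
    simp only [hi, dite_true]
    refine ⟨?_, ?_⟩
    · intro a ha
      obtain ⟨j, -, rfl⟩ := Finset.mem_image.mp ha
      exact hft (⟨i, hi⟩, j)
    · rw [Finset.card_image_of_injective _ fun a b hab => by simpa using hf hab]
      simp
  · intro i hi j hj hij
    have hi' : i ∈ I := hi
    have hj' : j ∈ I := hj
    simp only [Function.onFun, hi', hj', dite_true]
    rw [Finset.disjoint_left]
    rintro a ha hb
    obtain ⟨x, -, rfl⟩ := Finset.mem_image.mp ha
    obtain ⟨y, -, hy⟩ := Finset.mem_image.mp hb
    have := hf hy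
    simp only [Prod.mk.injEq, Subtype.mk.injEq] at this
    exact hij this.1.symm

/-- A set `U ⊆ S(v, r)` has at most `2 d ^ r` vertices, and `d ^ r * d ^ (r + 1) ≤ n / L`, so the
balls of radius `r + 1` around `U` are still in the sharp range. Removing those of radius `r` leaves
points of the spheres `S(u, r + 1)`. -/
lemma HasOneStepExpansion.disjointSpheres {G : SimpleGraph V} {d L η θ : ℝ}
    (hG : HasOneStepExpansion G d L η) (hη0 : 0 ≤ η) (hη1 : η ≤ 1) (hθ : θ ≤ 1 / 2)
    (hrad : ∀ r : ℕ, d ^ r ≤ Fintype.card V → r * η ≤ θ) (hL : 2 ≤ L)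
    (hLlog : L = Real.log (Fintype.card V)) (hd : L ^ 3 ≤ d) (hθd : 3 ≤ θ * d) :
    DisjointSpheres G d (2 * θ) := by
  classical
  intro v r _ hr2
  rw [Nat.card_eq_fintype_card, ← hLlog] at hr2
  set n : ℝ := (Fintype.card V : ℝ) with hn
  have hn0 : 0 ≤ n := by positivity
  have hL0 : 0 < L := by linarith
  have hd8 : 8 ≤ d := by nlinarith [sq_nonneg L, mul_nonneg hL0.le (sub_nonneg.mpr hL)]
  have hd0 : 0 < d := by linarith
  have hd1 : 1 ≤ d := by linarith
  have hb := hG.card_ballFinset_bounds hd1 hη0 hη1 hθ hrad hL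
  have hsq : d ^ r * d ^ (r + 1) ≤ n / L := by
    have h1 : d ^ (r + 1) * d ^ (r + 1) ≤ (√n * L) * (√n * L) := by gcongr
    have h2 : (√n * L) * (√n * L) = n * L ^ 2 := by
      calc _ = (√n * √n) * L ^ 2 := by ring
        _ = _ := by rw [Real.mul_self_sqrt hn0]
    rw [le_div_iff₀ hL0]
    refine le_of_mul_le_mul_right ?_ (show 0 < L ^ 2 by positivity)
    calc d ^ r * d ^ (r + 1) * L * L ^ 2 = d ^ r * d ^ (r + 1) * L ^ 3 := by ring
      _ ≤ d ^ r * d ^ (r + 1) * d := by gcongr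
      _ = d ^ (r + 1) * d ^ (r + 1) := by ring
      _ ≤ n * L ^ 2 := h1.trans h2.le
  have hnL : 0 ≤ n / L := by positivity
  have hdr : d ^ r ≤ n / L := by
    refine le_trans ?_ hsq
    exact le_mul_of_one_le_right (by positivity) (one_le_pow₀ hd1)
  have hball : ((ballFinset G {v} r).card : ℝ) ≤ 2 * d ^ r := by
    have h1 := (hb {v} r (by rw [mul_div_assoc]; simpa using hdr.trans (by linarith))).2
    refine h1.trans ?_
    simp only [Finset.card_singleton, Nat.cast_one, one_mul]
    gcongr
    linarith
  set D := d ^ (r + 1) with hD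
  have hD0 : 0 < D := by positivity
  set I : Finset V := Finset.univ.filter fun u => u ∈ sphere G v r with hI
  set k : ℕ := ⌊(1 - 2 * θ) * D⌋₊ + 1 with hk
  have hk1 : (k : ℝ) ≤ (1 - 2 * θ) * D + 1 := by
    rw [hk]; push_cast
    linarith [Nat.floor_le (show 0 ≤ (1 - 2 * θ) * D by
      refine mul_nonneg ?_ hD0.le; linarith)]
  have hk2 : (1 - 2 * θ) * D ≤ k := by
    rw [hk]; push_cast; exact (Nat.lt_floor_add_one _).le
  have hDd : d ≤ D := by
    rw [hD, pow_succ]; exact le_mul_of_one_le_left hd0.le (one_le_pow₀ hd1)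
  -- The three copies of `d ^ r` pay, per vertex of `U`, for the inner ball (at most `2 d ^ r`) and
  -- for rounding `k` up (at most `1 ≤ d ^ r`).
  have hθdr : 3 * d ^ r ≤ θ * D := by
    calc 3 * d ^ r ≤ θ * d * d ^ r := by gcongr
      _ = _ := by rw [hD]; ring
  have hdr1 : 1 ≤ d ^ r := one_le_pow₀ hd1
  obtain ⟨W, hW, hdisj⟩ := exists_pairwiseDisjoint_subsets_of_card I
    (fun u => Finset.univ.filter fun w => w ∈ sphere G u (r + 1)) k (by
      intro U hU
      have hUball : U ⊆ ballFinset G {v} r := by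
        intro u hu
        have : u ∈ sphere G v r := (Finset.mem_filter.mp (hU hu)).2
        simp only [mem_ballFinset, Finset.mem_singleton, exists_eq_left]
        exact le_of_eq this
      have hUc : (U.card : ℝ) ≤ 2 * d ^ r :=
        le_trans (by exact_mod_cast Finset.card_le_card hUball) hball
      have hUD : (U.card : ℝ) * D ≤ 2 * n / L := by
        calc _ ≤ 2 * d ^ r * D := by gcongr
          _ = 2 * (d ^ r * D) := by ring
          _ ≤ 2 * (n / L) := by gcongr
          _ = _ := by ring
      have hUd : (U.card : ℝ) * d ^ r ≤ 2 * n / L := by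
        refine le_trans ?_ hUD
        gcongr
        exact pow_le_pow_right₀ hd1 (Nat.le_succ r)
      have hlow := (hb U (r + 1) hUD).1
      have hup := (hb U r hUd).2
      have hsub : ballFinset G U (r + 1) ⊆ ballFinset G U r ∪
          U.biUnion fun u => Finset.univ.filter fun w => w ∈ sphere G u (r + 1) := by
        intro w hw
        obtain ⟨u, hu, huw⟩ := mem_ballFinset.mp hw
        rw [Finset.mem_union]
        by_cases h : w ∈ ball G u r
        · exact Or.inl (mem_ballFinset.mpr ⟨u, hu, h⟩)
        · right
          simp only [Finset.mem_biUnion, Finset.mem_filter, Finset.mem_univ, true_and]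
          refine ⟨u, hu, le_antisymm huw ?_⟩
          simp only [ball, Set.mem_ofPred_eq, not_le] at h
          push_cast
          exact Order.add_one_le_of_lt h
      have hcard := (Finset.card_le_card hsub).trans (Finset.card_union_le _ _)
      have hcard' : ((ballFinset G U (r + 1)).card : ℝ) ≤ (ballFinset G U r).card +
          (U.biUnion fun u => Finset.univ.filter fun w => w ∈ sphere G u (r + 1)).card := by
        exact_mod_cast hcard
      have hgoal : (U.card : ℝ) * k ≤
          (U.biUnion fun u => Finset.univ.filter fun w => w ∈ sphere G u (r + 1)).card := by
        have hU0 : (0 : ℝ) ≤ U.card := by positivity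
        have h1 : (U.card : ℝ) * k ≤ U.card * ((1 - 2 * θ) * D + d ^ r) := by
          gcongr; linarith
        have h2 : (1 + 2 * θ) * (U.card * d ^ r) ≤ 2 * (U.card * d ^ r) := by
          gcongr; linarith
        have h3 : (U.card : ℝ) * (3 * d ^ r) ≤ U.card * (θ * D) := by gcongr
        linarith
      exact_mod_cast hgoal)
  have hmem : ∀ u, u ∈ sphere G v r → u ∈ I := fun u hu => by simp [hI, hu]
  refine ⟨fun u => (W u : Set V), ?_, ?_, ?_⟩
  · intro u hu w hw
    exact (Finset.mem_filter.mp ((hW u (hmem u hu)).1 hw)).2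
  · intro a ha b hb hab
    exact Finset.disjoint_coe.mpr (hdisj (hmem a ha) (hmem b hb) hab)
  · intro u hu
    rw [Set.ncard_coe_finset, (hW u (hmem u hu)).2, ApproxEq, abs_le]
    constructor
    · linarith
    · linarith

end Growth

end MeynielGnp

/-! ### Choice of the error terms and conclusion. -/

namespace MeynielGnp

open MeasureTheory SimpleGraph Filter

/-- Taking logarithms, `3 r log L ≤ r log d ≤ L`; this is what makes the total error `o(1)`. -/
lemma radius_mul_le {n d L : ℝ} (hL : L = Real.log n) (hL2 : 2 ≤ L) (hd : L ^ 3 ≤ d)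
    {r : ℕ} (hr : d ^ r ≤ n) : r * (30 / L) ≤ 10 / Real.log L := by
  have hL0 : 0 < L := by linarith
  have hlog : 0 < Real.log L := Real.log_pos (by linarith)
  have hd0 : 0 < d := lt_of_lt_of_le (by positivity) hd
  have h1 : 3 * Real.log L ≤ Real.log d := by
    have h := Real.log_le_log (by positivity) hd
    rw [Real.log_pow] at h
    exact_mod_cast h
  have h2 : r * Real.log d ≤ L := by
    rw [hL, ← Real.log_pow]
    exact Real.log_le_log (by positivity) hr
  have h3 : r * (3 * Real.log L) ≤ L := le_trans (by gcongr) h2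
  rw [le_div_iff₀ hlog, mul_div_assoc', div_mul_eq_mul_div, div_le_iff₀ hL0]
  linarith

/-- Graphs with typical boundaries have both expansion properties. -/
lemma HasTypicalBoundaries.ballExpansion_and_disjointSpheres {V : Type*} [Fintype V]
    [DecidableEq V] {G : SimpleGraph V} {p d L : ℝ} {n : ℕ} (hV : Fintype.card V = n) (hn : 2 ≤ n)
    (hp0 : 0 ≤ p) (hp1 : p ≤ 1) (hd : d = p * (n - 1)) (hLlog : L = Real.log n) (hL : 30 ≤ L)
    (hLL : 20 ≤ Real.log L) (hLd : L ^ 3 ≤ d) (hG : HasTypicalBoundaries G p d (7 / L)) :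
    BallExpansion G d (1 / 48) (2 * (10 / Real.log L)) ∧
      DisjointSpheres G d (2 * (10 / Real.log L)) := by
  have hL0 : 0 < L := by linarith
  have hl0 : 0 < Real.log L := by linarith
  have hG1 := hG.hasOneStepExpansion hV hn hp0 hp1 hd (by linarith) hLd
  have hη0 : 0 ≤ 30 / L := by positivity
  have hη1 : 30 / L ≤ 1 := (div_le_one hL0).mpr hL
  have hθ : 10 / Real.log L ≤ 1 / 2 := by
    rw [div_le_div_iff₀ hl0 (by norm_num)]; linarith
  have hrad : ∀ r : ℕ, d ^ r ≤ Fintype.card V → r * (30 / L) ≤ 10 / Real.log L := by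
    intro r hr
    rw [hV] at hr
    exact radius_mul_le hLlog (by linarith) hLd hr
  have hLV : L = Real.log (Fintype.card V) := by rw [hV, hLlog]
  have hL2 : 24 * L ≤ L ^ 3 := by nlinarith [mul_nonneg hL0.le (sub_nonneg.mpr hL)]
  refine ⟨hG1.ballExpansion hη0 hη1 hθ hrad (by linarith) hLV (hL2.trans hLd),
    hG1.disjointSpheres hη0 hη1 hθ hrad (by linarith) hLV hLd ?_⟩
  rw [div_mul_eq_mul_div, le_div_iff₀ hl0]
  linarith [Real.log_le_self hL0.le]

end MeynielGnp

theorem lemma2p3 :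
    ∃ c : ℝ, 0 < c ∧ ∃ ε : ℕ → ℝ, Filter.Tendsto ε Filter.atTop (nhds 0) ∧
      ∀ p : ℕ → unitInterval,
        (∀ᶠ n : ℕ in Filter.atTop, Real.log (n : ℝ) ^ 3 ≤ (p n : ℝ) * ((n : ℝ) - 1)) →
        Filter.Tendsto
          (fun n : ℕ => SimpleGraph.binomialRandom (Fin n) (p n)
            {G : SimpleGraph (Fin n) |
              MeynielGnp.BallExpansion G ((p n : ℝ) * ((n : ℝ) - 1)) c (ε n) ∧
              MeynielGnp.DisjointSpheres G ((p n : ℝ) * ((n : ℝ) - 1)) (ε n)})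
          Filter.atTop (nhds 1) := by
  have hlog : Filter.Tendsto (fun n : ℕ => Real.log (n : ℝ)) Filter.atTop Filter.atTop :=
    Real.tendsto_log_atTop.comp tendsto_natCast_atTop_atTop
  have hloglog : Filter.Tendsto (fun n : ℕ => Real.log (Real.log (n : ℝ))) Filter.atTop Filter.atTop :=
    Real.tendsto_log_atTop.comp hlog
  refine ⟨1 / 48, by norm_num, fun n => 2 * (10 / Real.log (Real.log n)), ?_, ?_⟩
  · simpa using (hloglog.const_div_atTop 10).const_mul 2
  intro p hp
  have hlim : Filter.Tendsto (fun n : ℕ => ENNReal.ofReal (1 - 4 / (n : ℝ))) Filter.atTop (nhds 1) := by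
    have h : Filter.Tendsto (fun n : ℕ => 1 - 4 / (n : ℝ)) Filter.atTop (nhds (1 - 0)) :=
      tendsto_const_nhds.sub (tendsto_const_div_atTop_nhds_zero_nat 4)
    simpa using ENNReal.tendsto_ofReal h
  refine tendsto_of_tendsto_of_tendsto_of_le_of_le' hlim tendsto_const_nhds ?_
    (Filter.Eventually.of_forall fun n => MeasureTheory.prob_le_one)
  filter_upwards [hp, hlog.eventually_ge_atTop 30, hloglog.eventually_ge_atTop 20,
    Filter.eventually_ge_atTop 2] with n hd hL hLL hn
  have hV : Fintype.card (Fin n) = n := Fintype.card_fin n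
  have hL0 : 0 < Real.log (n : ℝ) := by linarith
  set L := Real.log (n : ℝ) with hLdef
  have hd4 : 4 ≤ (p n : ℝ) * ((n : ℝ) - 1) := by
    refine le_trans ?_ hd
    nlinarith [mul_nonneg hL0.le (sub_nonneg.mpr hL)]
  -- The 7 in `δ` is chosen so that `δ ^ 2 d ≥ 49 L ≥ 48 log n`.
  have hbad := MeynielGnp.binomialRandom_not_hasTypicalBoundaries_le (p n) hV hn rfl hd4
    (δ := 7 / L) (by positivity) (by rw [div_le_one hL0]; linarith) (by
      calc 48 * Real.log n ≤ (7 / L) ^ 2 * L ^ 3 := by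
            rw [← hLdef]; field_simp; norm_num
        _ ≤ _ := by gcongr)
  have hgood : 1 - 4 / (n : ℝ) ≤ (SimpleGraph.binomialRandom (Fin n) (p n)).real
      {G | MeynielGnp.HasTypicalBoundaries G (p n : ℝ) ((p n : ℝ) * ((n : ℝ) - 1)) (7 / L)} := by
    have h := MeasureTheory.probReal_compl_eq_one_sub (μ := SimpleGraph.binomialRandom (Fin n) (p n))
      (s := {G | MeynielGnp.HasTypicalBoundaries G (p n : ℝ) ((p n : ℝ) * ((n : ℝ) - 1)) (7 / L)})
      (Set.toFinite _).measurableSet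
    rw [Set.compl_ofPred] at h
    linarith
  calc ENNReal.ofReal (1 - 4 / (n : ℝ))
      ≤ SimpleGraph.binomialRandom (Fin n) (p n)
        {G | MeynielGnp.HasTypicalBoundaries G (p n : ℝ) ((p n : ℝ) * ((n : ℝ) - 1)) (7 / L)} :=
        (ENNReal.ofReal_le_ofReal hgood).trans_eq (MeasureTheory.ofReal_measureReal)
    _ ≤ _ := by
        refine MeasureTheory.measure_mono fun G hG => ?_
        exact hG.ballExpansion_and_disjointSpheres hV hn (p n).2.1 (p n).2.2 rfl hLdef hL hLL hd
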